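/- Let $A\in\mathbb{R}^{p\times n}$, $\Theta\in\mathbb{R}^{m\times n}$, $y\in\mathbb{R}^p$, let $\Phi:\mathbb{R}^m\to\mathbb{R}$ be convex, and let $\eta>0$. All norms are Euclidean. Consider the regularized least-squares problem $$\min_{x\in\mathbb{R}^n}\ \tfrac12\|y-Ax\|^2+\Phi(\Theta x).\qquad(P)$$ **Algorithms.** In the iterations below "$\in\arg\min$" means any choice of a minimizer, the starting vectors ($v^0,e^0$ and, where they occur, $u^0,d^0$) are arbitrary unless specified, and $k=0,1,2,\dots$ *Split Bregman (SB) method:* $$x^{k+1}\in\arg\min_x\tfrac12\|y-Ax\|^2+\tfrac{\eta}{2}\|\Theta x-v^k-e^k\|^2,$$ $$v^{k+1}\in\arg\min_v\Phi(v)+\tfrac{\eta}{2}\|\Theta x^{k+1}-v-e^k\|^2,\qquad e^{k+1}=e^k-\Theta x^{k+1}+v^{k+1}.$$ *Two-split ADMM* (splits $u=Ax$, $v=\Theta x$) with parameter $\rho>0$: $$x^{k+1}\in\arg\min_x\tfrac{\rho}{2}\|Ax-u^k-d^k\|^2+\tfrac{\eta}{2}\|\Theta x-v^k-e^k\|^2,$$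 $$u^{k+1}\in\arg\min_u\tfrac12\|y-u\|^2+\tfrac{\rho}{2}\|Ax^{k+1}-u-d^k\|^2,$$ $$v^{k+1}\in\arg\min_v\Phi(v)+\tfrac{\eta}{2}\|\Theta x^{k+1}-v-e^k\|^2,$$ $$d^{k+1}=d^k-Ax^{k+1}+u^{k+1},\qquad e^{k+1}=e^k-\Theta x^{k+1}+v^{k+1}.$$ *Simplified ADMM* with parameter $\rho>0$: the same $v$- and $e$-updates, no variable $d$, and $$x^{k+1}\in\arg\min_x\tfrac{\rho}{2}\|Ax-\rho^{-1}y-(1-\rho^{-1})u^k\|^2+\tfrac{\eta}{2}\|\Theta x-v^k-e^k\|^2,\qquad u^{k+1}=\tfrac{\rho}{\rho+1}Ax^{k+1}+\tfrac{1}{\rho+1}u^k.$$ *Inexact* versions of the SB method and of the two-split ADMM: each minimization at step $k$, formed from the actual (inexact) iterates, is solved only up to an $\ell_2$ error, i.e. the computed vector lies within distance $\varepsilon_k$ of a minimizer of that subproblem, where each error sequence $(\varepsilon_k)_k$ (one for each of the $x$-, $u$-, $v$-updates that occur) is summable; the updates of $d$ and $e$ are carried out exactly. **Theorem.** 1. For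 every $\rho>0$, the two-split ADMM initialized with $d^0=\rho^{-1}(y-u^0)$ satisfies $u^k+\rho d^k=y$ for all $k\ge0$. 2. For every $\rho>0$, sequences $(x^k,u^k,v^k,d^k,e^k)$ are two-split ADMM iterates with $d^0=\rho^{-1}(y-u^0)$ if and only if $(x^k,u^k,v^k,e^k)$ are simplified ADMM iterates and $d^k=\rho^{-1}(y-u^k)$ for all $k\ge 0$. 3. For $\rho=1$ the two-split ADMM is exactly the SB method: for every $u^0\in\mathbb{R}^p$, sequences $(x^k,v^k,e^k)$ are SB iterates if and only if there are sequences $(u^k)$, $(d^k)$, starting from the given $u^0$ and from $d^0=y-u^0$, such that $(x^k,u^k,v^k,d^k,e^k)$ are two-split ADMM iterates with $\rho=1$. 4. Suppose that $S=\begin{bmatrix}A\\ \Theta\end{bmatrix}$ has full column rank (nothing is assumed on the rank of $\Theta$ alone) and that $(P)$ has a minimizer. Then: - for every $\rho>0$ and all starting vectors, any inexact two-split ADMM iterates satisfy $x^k\to\hat x$, $u^k\to A\hat x$ and $v^k\to\Theta\hat x$ for some minimizer $\hat x$ of $(P)$; - for all starting vectors, any inexact SB iterates satisfy $x^k\to\hat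 x$ and $v^k\to\Theta\hat x$ for some minimizer $\hat x$ of $(P)$. In particular, if the minimizer of $(P)$ is unique, the limit $\hat x$ is that minimizer. -/

import Mathlib

namespace SplitBregman

/-- Real Euclidean space of dimension `n`, with the `ℓ²` norm. -/
abbrev Vec (n : ℕ) : Type := EuclideanSpace ℝ (Fin n)

/-- Matrix-vector product on Euclidean spaces. -/
noncomputable def mv {m n : ℕ} (M : Matrix (Fin m) (Fin n) ℝ) (x : Vec n) : Vec m :=
  WithLp.toLp 2 (M.mulVec x.ofLp)

/-- `x` is a (global, not necessarily unique) minimizer of `f`, that is, `x ∈ argmin f`. -/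
def IsArgmin {n : ℕ} (f : Vec n → ℝ) (x : Vec n) : Prop := IsMinOn f Set.univ x

/-- `x` is within `ℓ²` distance `ε` of a minimizer of `f`. -/
def IsApproxArgmin {n : ℕ} (f : Vec n → ℝ) (ε : ℝ) (x : Vec n) : Prop :=
  ∃ z, IsArgmin f z ∧ ‖x - z‖ ≤ ε

variable {n p m : ℕ}

/-- The regularized least-squares cost `½‖y - A x‖² + Φ(Θ x)`. -/
noncomputable def cost (A : Matrix (Fin p) (Fin n) ℝ) (Θ : Matrix (Fin m) (Fin n) ℝ)
    (y : Vec p) (Φ : Vec m → ℝ) (x : Vec n) : ℝ :=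
  1 / 2 * ‖y - mv A x‖ ^ 2 + Φ (mv Θ x)

/-- Cost of the `x`-subproblem of the split Bregman method. -/
noncomputable def sbCostX (A : Matrix (Fin p) (Fin n) ℝ) (Θ : Matrix (Fin m) (Fin n) ℝ)
    (y : Vec p) (η : ℝ) (v e : Vec m) (x : Vec n) : ℝ :=
  1 / 2 * ‖y - mv A x‖ ^ 2 + η / 2 * ‖mv Θ x - v - e‖ ^ 2

/-- Cost of the `v`-subproblem, common to all the methods. -/
noncomputable def costV (Θ : Matrix (Fin m) (Fin n) ℝ) (Φ : Vec m → ℝ) (η : ℝ)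
    (x : Vec n) (e : Vec m) (v : Vec m) : ℝ :=
  Φ v + η / 2 * ‖mv Θ x - v - e‖ ^ 2

/-- Cost of the `x`-subproblem of the two-split ADMM. -/
noncomputable def admmCostX (A : Matrix (Fin p) (Fin n) ℝ) (Θ : Matrix (Fin m) (Fin n) ℝ)
    (ρ η : ℝ) (u : Vec p) (v : Vec m) (d : Vec p) (e : Vec m) (x : Vec n) : ℝ :=
  ρ / 2 * ‖mv A x - u - d‖ ^ 2 + η / 2 * ‖mv Θ x - v - e‖ ^ 2

/-- Cost of the `u`-subproblem of the two-split ADMM. -/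
noncomputable def admmCostU (A : Matrix (Fin p) (Fin n) ℝ) (y : Vec p) (ρ : ℝ)
    (x : Vec n) (d : Vec p) (u : Vec p) : ℝ :=
  1 / 2 * ‖y - u‖ ^ 2 + ρ / 2 * ‖mv A x - u - d‖ ^ 2

/-- Cost of the `x`-subproblem of the simplified two-split ADMM. -/
noncomputable def simplifiedCostX (A : Matrix (Fin p) (Fin n) ℝ)
    (Θ : Matrix (Fin m) (Fin n) ℝ) (y : Vec p) (ρ η : ℝ) (u : Vec p) (v e : Vec m)
    (x : Vec n) : ℝ :=
  ρ / 2 * ‖mv A x - ρ⁻¹ • y - (1 - ρ⁻¹) • u‖ ^ 2 + η / 2 * ‖mv Θ x - v - e‖ ^ 2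

/-- `(x, v, e)` is a sequence of (exact) split Bregman iterates. The entry `x 0` plays no role. -/
structure IsSB (A : Matrix (Fin p) (Fin n) ℝ) (Θ : Matrix (Fin m) (Fin n) ℝ) (y : Vec p)
    (Φ : Vec m → ℝ) (η : ℝ) (x : ℕ → Vec n) (v e : ℕ → Vec m) : Prop where
  x_update : ∀ k, IsArgmin (sbCostX A Θ y η (v k) (e k)) (x (k + 1))
  v_update : ∀ k, IsArgmin (costV Θ Φ η (x (k + 1)) (e k)) (v (k + 1))
  e_update : ∀ k, e (k + 1) = e k - mv Θ (x (k + 1)) + v (k + 1)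

/-- `(x, u, v, d, e)` is a sequence of (exact) two-split ADMM iterates. -/
structure IsADMM (A : Matrix (Fin p) (Fin n) ℝ) (Θ : Matrix (Fin m) (Fin n) ℝ) (y : Vec p)
    (Φ : Vec m → ℝ) (ρ η : ℝ) (x : ℕ → Vec n) (u : ℕ → Vec p) (v : ℕ → Vec m)
    (d : ℕ → Vec p) (e : ℕ → Vec m) : Prop where
  x_update : ∀ k, IsArgmin (admmCostX A Θ ρ η (u k) (v k) (d k) (e k)) (x (k + 1))
  u_update : ∀ k, IsArgmin (admmCostU A y ρ (x (k + 1)) (d k)) (u (k + 1))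
  v_update : ∀ k, IsArgmin (costV Θ Φ η (x (k + 1)) (e k)) (v (k + 1))
  d_update : ∀ k, d (k + 1) = d k - mv A (x (k + 1)) + u (k + 1)
  e_update : ∀ k, e (k + 1) = e k - mv Θ (x (k + 1)) + v (k + 1)

/-- `(x, u, v, e)` is a sequence of iterates of the simplified two-split ADMM. -/
structure IsSimplifiedADMM (A : Matrix (Fin p) (Fin n) ℝ) (Θ : Matrix (Fin m) (Fin n) ℝ)
    (y : Vec p) (Φ : Vec m → ℝ) (ρ η : ℝ) (x : ℕ → Vec n) (u : ℕ → Vec p)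
    (v e : ℕ → Vec m) : Prop where
  x_update : ∀ k, IsArgmin (simplifiedCostX A Θ y ρ η (u k) (v k) (e k)) (x (k + 1))
  u_update : ∀ k, u (k + 1) = (ρ / (ρ + 1)) • mv A (x (k + 1)) + (1 / (ρ + 1)) • u k
  v_update : ∀ k, IsArgmin (costV Θ Φ η (x (k + 1)) (e k)) (v (k + 1))
  e_update : ∀ k, e (k + 1) = e k - mv Θ (x (k + 1)) + v (k + 1)

/-- Inexact split Bregman iterates: at step `k` the `x`- and `v`-subproblems, formed from the
actual (inexact) iterates, are solved up to `ℓ²` errors `εx k` and `εv k`. -/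
structure IsInexactSB (A : Matrix (Fin p) (Fin n) ℝ) (Θ : Matrix (Fin m) (Fin n) ℝ)
    (y : Vec p) (Φ : Vec m → ℝ) (η : ℝ) (εx εv : ℕ → ℝ) (x : ℕ → Vec n)
    (v e : ℕ → Vec m) : Prop where
  x_update : ∀ k, IsApproxArgmin (sbCostX A Θ y η (v k) (e k)) (εx k) (x (k + 1))
  v_update : ∀ k, IsApproxArgmin (costV Θ Φ η (x (k + 1)) (e k)) (εv k) (v (k + 1))
  e_update : ∀ k, e (k + 1) = e k - mv Θ (x (k + 1)) + v (k + 1)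

/-- Inexact two-split ADMM iterates: at step `k` the `x`-, `u`- and `v`-subproblems, formed from
the actual (inexact) iterates, are solved up to `ℓ²` errors `εx k`, `εu k` and `εv k`. -/
structure IsInexactADMM (A : Matrix (Fin p) (Fin n) ℝ) (Θ : Matrix (Fin m) (Fin n) ℝ)
    (y : Vec p) (Φ : Vec m → ℝ) (ρ η : ℝ) (εx εu εv : ℕ → ℝ) (x : ℕ → Vec n)
    (u : ℕ → Vec p) (v : ℕ → Vec m) (d : ℕ → Vec p) (e : ℕ → Vec m) : Prop where
  x_update : ∀ k,
    IsApproxArgmin (admmCostX A Θ ρ η (u k) (v k) (d k) (e k)) (εx k) (x (k + 1))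
  u_update : ∀ k, IsApproxArgmin (admmCostU A y ρ (x (k + 1)) (d k)) (εu k) (u (k + 1))
  v_update : ∀ k, IsApproxArgmin (costV Θ Φ η (x (k + 1)) (e k)) (εv k) (v (k + 1))
  d_update : ∀ k, d (k + 1) = d k - mv A (x (k + 1)) + u (k + 1)
  e_update : ∀ k, e (k + 1) = e k - mv Θ (x (k + 1)) + v (k + 1)

/-- The stacked matrix `S = [A; Θ]` has full column rank. -/
def FullColumnRank (A : Matrix (Fin p) (Fin n) ℝ) (Θ : Matrix (Fin m) (Fin n) ℝ) : Prop :=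
  (Matrix.fromRows A Θ).rank = n

end SplitBregman

/-! The algebraic claims rest on the optimality condition of the `u`-step, `(1 + ρ) u = y + ρ (A x -
d)`. Combined with the `d`-update it gives `u + ρ d = y` after every exact step, so `d` is redundant
and can be eliminated. At `ρ = 1` the elimination also removes `u` from the `x`-subproblem, leaving
the split Bregman step.

For convergence, (P) is read as minimizing a convex `g` over the range of a linear map `S`, and ADMM
becomes Douglas–Rachford splitting. With `P` the projection onto the range and `q k = S x (k+1) - b
k`, exact steps satisfy `q (k+1) = T (q k)`, where `T q = P (2 prox q - q) - prox q + q`. This `T`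
is firmly nonexpansive (`douglasRachford_firmly_nonexpansive`). A minimizer yields a fixed point
through a subgradient orthogonal to the range (`exists_subgradient_orthogonal`), and each fixed
point `r` gives a minimizer `x` with `S x = prox r`. Summable subproblem errors become summable
errors in `q`, so `exists_tendsto_fixedPoint` applies. The rank hypothesis makes `S` injective,
which turns convergence of `S x` into convergence of `x`.

Inexact split Bregman is inexact ADMM at `ρ = 1` with an exact `u`-step. -/

open Filter Topology
open scoped RealInnerProductSpace

namespace SplitBregman

/-! ### Quasi-Fejér sequences and inexact fixed-point iteration -/

section Abstract

/-- A nonnegative sequence that increases by at most a summable error at each step converges. -/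
lemma exists_tendsto_of_le_add_summable {a ε : ℕ → ℝ} (ha : ∀ k, 0 ≤ a k) (hε : Summable ε)
    (hε0 : ∀ k, 0 ≤ ε k) (h : ∀ k, a (k + 1) ≤ a k + ε k) : ∃ l, Tendsto a atTop (𝓝 l) := by
  have hanti : Antitone fun k => a k - ∑ i ∈ Finset.range k, ε i :=
    antitone_nat_of_succ_le fun k => by
      rw [Finset.sum_range_succ]
      linarith [h k]
  have hbdd : BddBelow (Set.range fun k => a k - ∑ i ∈ Finset.range k, ε i) := by
    refine ⟨-∑' i, ε i, ?_⟩
    rintro _ ⟨k, rfl⟩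
    have := hε.sum_le_tsum (Finset.range k) fun i _ => hε0 i
    simp only
    linarith [ha k]
  have h1 := (tendsto_atTop_ciInf hanti hbdd).add hε.hasSum.tendsto_sum_nat
  exact ⟨_, h1.congr fun k => by ring⟩

/-- The inexact Krasnoselskii–Mann iteration of a firmly nonexpansive map with a fixed point
converges to a fixed point. -/
lemma exists_tendsto_fixedPoint {W : Type*} [NormedAddCommGroup W] [ProperSpace W] {T : W → W}
    (hT : ∀ a b, ‖T a - T b‖ ^ 2 + ‖(a - T a) - (b - T b)‖ ^ 2 ≤ ‖a - b‖ ^ 2)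
    (hfix : ∃ p, T p = p) {q : ℕ → W} {ε : ℕ → ℝ} (hε : Summable ε)
    (hq : ∀ k, ‖q (k + 1) - T (q k)‖ ≤ ε k) :
    ∃ p, T p = p ∧ Tendsto q atTop (𝓝 p) := by
  have hε0 : ∀ k, 0 ≤ ε k := fun k => (norm_nonneg _).trans (hq k)
  have hlip : ∀ a b, ‖T a - T b‖ ≤ ‖a - b‖ := fun a b =>
    le_of_sq_le_sq (by nlinarith [hT a b, sq_nonneg ‖(a - T a) - (b - T b)‖]) (norm_nonneg _)
  have hcont : Continuous T :=
    (LipschitzWith.of_dist_le_mul (K := 1) fun a b => by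
      simpa [dist_eq_norm] using hlip a b).continuous
  have hstep : ∀ p, T p = p → ∀ k, ‖q (k + 1) - p‖ ≤ ‖T (q k) - p‖ + ε k := fun p _ k => by
    have := norm_add_le (q (k + 1) - T (q k)) (T (q k) - p)
    rw [sub_add_sub_cancel] at this
    linarith [hq k]
  have hle : ∀ p, T p = p → ∀ k, ‖T (q k) - p‖ ≤ ‖q k - p‖ := fun p hp k => by
    simpa [hp] using hlip (q k) p
  have hconv : ∀ p, T p = p → ∃ l, Tendsto (fun k => ‖q k - p‖) atTop (𝓝 l) := fun p hp =>
    exists_tendsto_of_le_add_summable (fun _ => norm_nonneg _) hε hε0 fun k =>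
      (hstep p hp k).trans (by linarith [hle p hp k])
  obtain ⟨p, hp⟩ := hfix
  obtain ⟨l, hl⟩ := hconv p hp
  -- Both distances have the same limit, so firm nonexpansiveness, which bounds the squared residual
  -- by the difference of their squares, forces `q k - T (q k) → 0`.
  have hTl : Tendsto (fun k => ‖T (q k) - p‖) atTop (𝓝 l) := by
    refine tendsto_of_tendsto_of_tendsto_of_le_of_le
      (g := fun k => ‖q (k + 1) - p‖ - ε k) ?_ hl (fun k => ?_) (hle p hp)
    · simpa using (hl.comp (tendsto_add_atTop_nat 1)).sub hε.tendsto_atTop_zero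
    · simp only
      linarith [hstep p hp k]
  have hres : Tendsto (fun k => q k - T (q k)) atTop (𝓝 0) := by
    rw [tendsto_zero_iff_norm_tendsto_zero]
    have h2 : Tendsto (fun k => ‖q k - T (q k)‖ ^ 2) atTop (𝓝 0) := by
      refine squeeze_zero (fun _ => sq_nonneg _)
        (g := fun k => ‖q k - p‖ ^ 2 - ‖T (q k) - p‖ ^ 2) (fun k => ?_) ?_
      · have := hT (q k) p
        rw [hp, sub_self, sub_zero] at this
        linarith
      · simpa using (hl.pow 2).sub (hTl.pow 2)
    simpa using h2.sqrt
  have hbdd : Bornology.IsBounded (Set.range q) := by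
    obtain ⟨C, hC⟩ := hl.bddAbove_range
    refine (Metric.isBounded_closedBall (x := p) (r := C)).subset ?_
    rintro _ ⟨k, rfl⟩
    rw [mem_closedBall_iff_norm]
    exact hC ⟨k, rfl⟩
  obtain ⟨r, -, φ, hφ, hr⟩ := tendsto_subseq_of_bounded hbdd fun k => Set.mem_range_self k
  have hTr : T r = r := by
    have h1 := hres.comp hφ.tendsto_atTop
    have h2 := hr.sub ((hcont.tendsto r).comp hr)
    exact (sub_eq_zero.mp (tendsto_nhds_unique h2 h1)).symm
  refine ⟨r, hTr, ?_⟩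
  -- The cluster point is itself a fixed point, so the whole sequence of distances to it converges;
  -- a subsequence tends to `0`, hence so does the sequence.
  obtain ⟨l', hl'⟩ := hconv r hTr
  have h0 : Tendsto (fun k => ‖q (φ k) - r‖) atTop (𝓝 0) := by
    simpa using (hr.sub_const r).norm
  have : l' = 0 := tendsto_nhds_unique (hl'.comp hφ.tendsto_atTop) h0
  rw [tendsto_iff_norm_sub_tendsto_zero]
  exact this ▸ hl'

/-! ### Proximal maps and subgradients -/

variable {W : Type*} [NormedAddCommGroup W] [InnerProductSpace ℝ W]

/-- The proximal variational inequality characterizing `z = prox_g q`. -/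
def IsProx (g : W → ℝ) (q z : W) : Prop := ∀ w, g z + ⟪q - z, w - z⟫ ≤ g w

lemma norm_sub_sq_expand (w z q : W) :
    ‖w - q‖ ^ 2 = ‖z - q‖ ^ 2 - 2 * ⟪q - z, w - z⟫ + ‖w - z‖ ^ 2 := by
  rw [show w - q = (w - z) - (q - z) by abel, norm_sub_sq_real, norm_sub_rev z q,
    real_inner_comm]
  ring

lemma isProx_of_isMinOn {g : W → ℝ} (hg : ConvexOn ℝ Set.univ g) {q z : W}
    (h : ∀ w, g z + 1 / 2 * ‖z - q‖ ^ 2 ≤ g w + 1 / 2 * ‖w - q‖ ^ 2) : IsProx g q z := by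
  intro w
  -- Compare `z` with `z + t (w - z)`: after convexity and division by `t`, the quadratic remainder
  -- is of order `t` and vanishes in the limit.
  have key : ∀ t : ℝ, 0 < t → t ≤ 1 →
      g z + ⟪q - z, w - z⟫ ≤ g w + t / 2 * ‖w - z‖ ^ 2 := fun t ht ht1 => by
    have h1 := h (z + t • (w - z))
    have h2 := hg.2 (Set.mem_univ z) (Set.mem_univ w) (sub_nonneg.2 ht1) ht.le (by ring)
    rw [show (1 - t) • z + t • w = z + t • (w - z) by module] at h2
    rw [norm_sub_sq_expand (z + t • (w - z)) z q, add_sub_cancel_left, inner_smul_right,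
      norm_smul, mul_pow, Real.norm_eq_abs, sq_abs] at h1
    simp only [smul_eq_mul] at h2
    have h3 : t * (g z + ⟪q - z, w - z⟫) ≤ t * (g w + t / 2 * ‖w - z‖ ^ 2) := by nlinarith
    exact le_of_mul_le_mul_left h3 ht
  have hlim : Tendsto (fun t : ℝ => g w + t / 2 * ‖w - z‖ ^ 2) (𝓝[>] 0)
      (𝓝 (g w + 0 / 2 * ‖w - z‖ ^ 2)) :=
    (Continuous.tendsto (by fun_prop) _).mono_left nhdsWithin_le_nhds
  have := ge_of_tendsto hlim (b := g z + ⟪q - z, w - z⟫) (by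
    filter_upwards [Ioc_mem_nhdsGT (zero_lt_one' ℝ)] with t ht using key t ht.1 ht.2)
  simpa using this

/-- Testing each variational inequality at the other point and adding cancels `g`: this is
monotonicity of the subdifferential. -/
lemma IsProx.inner_nonneg {g : W → ℝ} {q z q' z' : W} (h : IsProx g q z) (h' : IsProx g q' z') :
    0 ≤ ⟪(q - q') - (z - z'), z - z'⟫ := by
  have h1 := h z'
  have h2 := h' z
  rw [show (q - q') - (z - z') = (q - z) - (q' - z') by abel, inner_sub_left]
  rw [← neg_sub z z', inner_neg_right] at h1
  linarith

/-- Cauchy–Schwarz applied to monotonicity. It supplies both uniqueness and continuity of the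
proximal map. -/
lemma IsProx.norm_sub_le {g : W → ℝ} {q z q' z' : W} (h : IsProx g q z) (h' : IsProx g q' z') :
    ‖z - z'‖ ≤ ‖q - q'‖ := by
  have h1 := h.inner_nonneg h'
  rw [inner_sub_left, real_inner_self_eq_norm_sq] at h1
  have h2 := real_inner_le_norm (q - q') (z - z')
  by_contra! hlt
  nlinarith [norm_nonneg (q - q')]

lemma IsProx.unique {g : W → ℝ} {q z z' : W} (h : IsProx g q z) (h' : IsProx g q z') : z = z' := by
  have := h.norm_sub_le h'
  rw [sub_self, norm_zero] at this
  exact sub_eq_zero.1 (norm_le_zero_iff.1 this)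

/-- A convex function minimized over a subspace `V` at `z₀` has a subgradient at `z₀` that is
orthogonal to `V`. -/
lemma exists_subgradient_orthogonal [FiniteDimensional ℝ W] {g : W → ℝ}
    (hg : ConvexOn ℝ Set.univ g) (V : Submodule ℝ W) {z₀ : W} (hz₀ : z₀ ∈ V)
    (hmin : ∀ w ∈ V, g z₀ ≤ g w) :
    ∃ b : W, (∀ w ∈ V, ⟪b, w⟫ = 0) ∧ ∀ w, g z₀ + ⟪b, w - z₀⟫ ≤ g w := by
  have hgc : Continuous g := by
    simpa [continuousOn_univ] using hg.continuousOn isOpen_univ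
  have hopen : IsOpen {p : W × ℝ | p.1 ∈ Set.univ ∧ g p.1 < p.2} := by
    simpa using isOpen_lt (hgc.comp continuous_fst) continuous_snd
  have hconv : Convex ℝ ((V : Set W) ×ˢ ({g z₀} : Set ℝ)) := V.convex.prod (convex_singleton _)
  have hdisj : Disjoint {p : W × ℝ | p.1 ∈ Set.univ ∧ g p.1 < p.2}
      ((V : Set W) ×ˢ ({g z₀} : Set ℝ)) := by
    rw [Set.disjoint_left]
    rintro ⟨w, r⟩ ⟨-, h1⟩ ⟨h2, h3⟩
    simp only [Set.mem_singleton_iff] at h3 h1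
    exact absurd (hmin w h2) (by linarith)
  -- Separate the open strict epigraph from `V × {g z₀}`; the subgradient is the horizontal part of
  -- the functional divided by minus its vertical slope `s`, which is negative.
  obtain ⟨f, c, hf1, hf2⟩ :=
    geometric_hahn_banach_open hg.convex_strict_epigraph hopen hconv hdisj
  have hsplit : ∀ w r, f (w, r) = f (w, 0) + r * f (0, 1) := fun w r => by
    rw [show (w, r) = (w, (0 : ℝ)) + r • ((0 : W), (1 : ℝ)) by simp, map_add, map_smul,
      smul_eq_mul]
  set s := f (0, 1) with hs
  have hlt : ∀ w r, g w < r → f (w, 0) + r * s < c := fun w r h => by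
    rw [← hsplit]
    exact hf1 (w, r) ⟨trivial, h⟩
  have hge : ∀ w ∈ V, c ≤ f (w, 0) + g z₀ * s := fun w hw => by
    rw [← hsplit]
    exact hf2 (w, g z₀) ⟨hw, rfl⟩
  have hsneg : s < 0 := by
    have h1 := hlt z₀ (g z₀ + 1) (by linarith)
    have h2 := hge z₀ hz₀
    linarith
  have hle : ∀ w, f (w, 0) + g w * s ≤ c := fun w => by
    have hlim : Tendsto (fun r : ℝ => f (w, 0) + r * s) (𝓝[>] (g w)) (𝓝 (f (w, 0) + g w * s)) :=
      (Continuous.tendsto (by fun_prop) _).mono_left nhdsWithin_le_nhds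
    exact le_of_tendsto hlim (by
      filter_upwards [self_mem_nhdsWithin] with r hr using (hlt w r hr).le)
  have hV : ∀ w ∈ V, f (w, 0) = 0 := fun w hw => by
    by_contra hne
    -- A linear form bounded below on a subspace is zero: this multiple of `w` has value exactly one
    -- below the bound.
    have h1 := hge ((((c - g z₀ * s) - 1) / f (w, 0)) • w) (V.smul_mem _ hw)
    rw [show ((((c - g z₀ * s) - 1) / f (w, 0)) • w, (0 : ℝ)) =
      (((c - g z₀ * s) - 1) / f (w, 0)) • (w, (0 : ℝ)) by simp, map_smul, smul_eq_mul,
      div_mul_cancel₀ _ hne] at h1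
    linarith
  let b : W := (InnerProductSpace.toDual ℝ W).symm
    ((-s⁻¹) • f.comp (ContinuousLinearMap.inl ℝ W ℝ))
  have hb : ∀ w, ⟪b, w⟫ = -s⁻¹ * f (w, 0) := fun w => by
    simp only [b, InnerProductSpace.toDual_symm_apply]
    simp
  refine ⟨b, fun w hw => by rw [hb, hV w hw, mul_zero], fun w => ?_⟩
  have h1 := hge z₀ hz₀
  have h2 := hle w
  have h3 := hV z₀ hz₀
  rw [inner_sub_right, hb, hb, h3]
  rw [h3] at h1
  have h4 : f (w, 0) ≤ (-s) * (g w - g z₀) := by linarith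
  have h5 : -s⁻¹ * f (w, 0) ≤ -s⁻¹ * ((-s) * (g w - g z₀)) :=
    mul_le_mul_of_nonneg_left h4 (by simpa using hsneg.le)
  have h6 : -s⁻¹ * ((-s) * (g w - g z₀)) = g w - g z₀ := by
    rw [← mul_assoc, neg_mul_neg, inv_mul_cancel₀ hsneg.ne, one_mul]
  linarith

/-- The proximal map of a finite convex function is everywhere defined. -/
lemma exists_isProx [FiniteDimensional ℝ W] {g : W → ℝ} (hg : ConvexOn ℝ Set.univ g) (q : W) :
    ∃ z, IsProx g q z := by
  have hgc : Continuous g := by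
    simpa [continuousOn_univ] using hg.continuousOn isOpen_univ
  -- With `V = ⊥` this is just a subgradient at `0`; its affine minorant is dominated at infinity by
  -- the quadratic term, whence coercivity.
  obtain ⟨b, -, hb⟩ := exists_subgradient_orthogonal hg ⊥ (z₀ := 0) (by simp)
    (by simp)
  have hcoer : Tendsto (fun w => g w + 1 / 2 * ‖w - q‖ ^ 2) (cocompact W) atTop := by
    have h1 : Tendsto (fun w : W => g 0 - (‖b‖ + ‖q‖) * ‖w‖ + 1 / 2 * ‖w‖ ^ 2)
        (cocompact W) atTop := by
      have h2 : Tendsto (fun r : ℝ => g 0 + r * (1 / 2 * r - (‖b‖ + ‖q‖))) atTop atTop := by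
        refine tendsto_atTop_add_const_left _ _ (tendsto_id.atTop_mul_atTop₀ ?_)
        exact tendsto_atTop_add_const_right _ _ (tendsto_id.const_mul_atTop (by norm_num))
      refine (h2.comp (tendsto_norm_cocompact_atTop (E := W))).congr fun w => ?_
      simp only [Function.comp]
      ring
    refine tendsto_atTop_mono (fun w => ?_) h1
    have h3 := hb w
    rw [sub_zero] at h3
    have h4 := neg_le_of_abs_le (abs_real_inner_le_norm b w)
    have h5 := real_inner_le_norm w q
    rw [norm_sub_sq_real]
    nlinarith [sq_nonneg ‖q‖]
  have hcont : Continuous fun w => g w + 1 / 2 * ‖w - q‖ ^ 2 := by fun_prop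
  obtain ⟨z, hz⟩ := hcont.exists_forall_le hcoer
  exact ⟨z, isProx_of_isMinOn hg hz⟩

/-! ### ADMM as Douglas–Rachford splitting -/

lemma eq_starProjection_of_isMinOn {E : Type*} [AddCommGroup E] [Module ℝ E]
    [FiniteDimensional ℝ W] (S : E →ₗ[ℝ] W) {a : W} {x : E}
    (h : ∀ w, ‖S x - a‖ ≤ ‖S w - a‖) :
    S x = (LinearMap.range S).starProjection a := by
  have hmin : ‖a - S x‖ = ⨅ w : LinearMap.range S, ‖a - w‖ := by
    refine le_antisymm (le_ciInf ?_)
      (ciInf_le (f := fun w : LinearMap.range S => ‖a - w‖) ⟨0, ?_⟩ ⟨S x, x, rfl⟩)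
    · rintro ⟨_, w, rfl⟩
      simpa [norm_sub_rev] using h w
    · rintro _ ⟨w, rfl⟩
      exact norm_nonneg _
  have := ((LinearMap.range S).norm_eq_iInf_iff_real_inner_eq_zero
    (S.mem_range_self x)).1 hmin
  exact (Submodule.eq_starProjection_of_mem_of_inner_eq_zero (S.mem_range_self x) this).symm

/-- The Douglas–Rachford operator is firmly nonexpansive. -/
lemma douglasRachford_firmly_nonexpansive [FiniteDimensional ℝ W] (V : Submodule ℝ W)
    {g : W → ℝ} {q z q' z' : W} (h : IsProx g q z) (h' : IsProx g q' z') {t t' : W}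
    (ht : t = V.starProjection ((2 : ℝ) • z - q) - z + q)
    (ht' : t' = V.starProjection ((2 : ℝ) • z' - q') - z' + q') :
    ‖t - t'‖ ^ 2 + ‖(q - t) - (q' - t')‖ ^ 2 ≤ ‖q - q'‖ ^ 2 := by
  have h1 := h.inner_nonneg h'
  set Δ := (2 : ℝ) • (z - z') - (q - q') with hΔ
  have h2 : ⟪Δ - V.starProjection Δ, V.starProjection Δ⟫ = 0 :=
    Submodule.starProjection_inner_eq_zero _ _ (V.starProjection_apply_mem Δ)
  have e1 : t - t' = V.starProjection Δ - (z - z') + (q - q') := by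
    rw [ht, ht', hΔ]
    simp only [map_sub, map_smul]
    module
  have e2 : (q - t) - (q' - t') = (z - z') - V.starProjection Δ := by
    rw [sub_sub_sub_comm, e1]
    abel
  rw [e1, e2]
  set a := V.starProjection Δ
  set dz := z - z'
  set dq := q - q'
  have e3 : dq = (a - dz + dq) + (dz - a) := by abel
  have e4 : ‖dq‖ ^ 2 = ‖a - dz + dq‖ ^ 2 + 2 * ⟪a - dz + dq, dz - a⟫ + ‖dz - a‖ ^ 2 := by
    conv_lhs => rw [e3, norm_add_sq_real]
  -- The cross term is nonnegative: the first summand by monotonicity of the prox, while the second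
  -- vanishes by orthogonality of the projection.
  have e5 : ⟪a - dz + dq, dz - a⟫ = ⟪dq - dz, dz⟫ + ⟪Δ - a, a⟫ := by
    rw [hΔ]
    simp only [inner_add_left, inner_sub_left, inner_sub_right, inner_smul_left,
      RCLike.conj_to_real]
    rw [real_inner_comm dz a]
    ring
  linarith

/-- Convergence of the inexact alternating direction method of multipliers for
`min_x g (S x)` with `S` injective. -/
theorem inexact_admm_tendsto {E : Type*} [NormedAddCommGroup E] [NormedSpace ℝ E]
    [FiniteDimensional ℝ E] [FiniteDimensional ℝ W] (S : E →ₗ[ℝ] W)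
    (hS : Function.Injective S) {g : W → ℝ} (hg : ConvexOn ℝ Set.univ g)
    (hmin : ∃ x₀, ∀ w, g (S x₀) ≤ g (S w)) {εx εz : ℕ → ℝ} (hεx : Summable εx)
    (hεz : Summable εz) {x : ℕ → E} {z b : ℕ → W}
    (hx : ∀ k, ∃ x', (∀ w, ‖S x' - (z k + b k)‖ ≤ ‖S w - (z k + b k)‖) ∧ ‖x (k + 1) - x'‖ ≤ εx k)
    (hz : ∀ k, ∃ z', (∀ w, g z' + 1 / 2 * ‖z' - (S (x (k + 1)) - b k)‖ ^ 2 ≤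
      g w + 1 / 2 * ‖w - (S (x (k + 1)) - b k)‖ ^ 2) ∧ ‖z (k + 1) - z'‖ ≤ εz k)
    (hb : ∀ k, b (k + 1) = b k - S (x (k + 1)) + z (k + 1)) :
    ∃ xhat, (∀ w, g (S xhat) ≤ g (S w)) ∧ Tendsto x atTop (𝓝 xhat) ∧
      Tendsto z atTop (𝓝 (S xhat)) := by
  have : ProperSpace W := FiniteDimensional.proper ℝ W
  set P := (LinearMap.range S).starProjection with hP
  choose prox hprox using exists_isProx hg
  let T : W → W := fun q => P ((2 : ℝ) • prox q - q) - prox q + q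
  have hT : ∀ q q', ‖T q - T q'‖ ^ 2 + ‖(q - T q) - (q' - T q')‖ ^ 2 ≤ ‖q - q'‖ ^ 2 :=
    fun q q' => douglasRachford_firmly_nonexpansive _ (hprox q) (hprox q') rfl rfl
  have hfix : ∃ q, T q = q := by
    obtain ⟨x₀, hx₀⟩ := hmin
    obtain ⟨c, hc1, hc2⟩ := exists_subgradient_orthogonal hg (LinearMap.range S) (z₀ := S x₀)
      ⟨x₀, rfl⟩ (by rintro _ ⟨w, rfl⟩; exact hx₀ w)
    have hpr : prox (S x₀ + c) = S x₀ :=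
      (hprox _).unique fun w => by simpa using hc2 w
    -- Since `c` is a subgradient at `S x₀`, the prox sends this point to `S x₀`; since `c` is
    -- orthogonal to the range, the projection sends the reflected point `S x₀ - c` back to `S x₀`.
    refine ⟨S x₀ + c, ?_⟩
    have hPc : P ((2 : ℝ) • S x₀ - (S x₀ + c)) = S x₀ :=
      Submodule.eq_starProjection_of_mem_of_inner_eq_zero ⟨x₀, rfl⟩ fun w hw => by
        rw [show (2 : ℝ) • S x₀ - (S x₀ + c) - S x₀ = -c by module, inner_neg_left, hc1 w hw,
          neg_zero]
    simp only [T, hpr, hPc]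
    abel
  let Sc : E →L[ℝ] W := S.toContinuousLinearMap
  have hSc : ∀ w, ‖S w‖ ≤ ‖Sc‖ * ‖w‖ := Sc.le_opNorm
  choose x' hx'1 hx'2 using hx
  choose z' hz'1 hz'2 using hz
  have hSx' : ∀ k, S (x' k) = P (z k + b k) := fun k => eq_starProjection_of_isMinOn S (hx'1 k)
  let q : ℕ → W := fun k => S (x (k + 1)) - b k
  have hz' : ∀ k, z' k = prox (q k) := fun k => (isProx_of_isMinOn hg (hz'1 k)).unique (hprox _)
  have hb' : ∀ k, b (k + 1) = z (k + 1) - q k := fun k => by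
    rw [hb k]
    simp only [q]
    abel
  have hxerr : ∀ k, ‖S (x (k + 1)) - P (z k + b k)‖ ≤ ‖Sc‖ * εx k := fun k => by
    rw [← hSx', ← map_sub]
    exact (hSc _).trans (mul_le_mul_of_nonneg_left (hx'2 k) (norm_nonneg _))
  -- A `z`-error `δ` enters as `2 P δ - δ`, hence the factor `3`. The `x`-error is that of the next
  -- step, because `q (k + 1)` involves `x (k + 2)`.
  have hq : ∀ k, ‖q (k + 1) - T (q k)‖ ≤ ‖Sc‖ * εx (k + 1) + 3 * εz k := fun k => by
    have e : q (k + 1) - T (q k) = (S (x (k + 2)) - P (z (k + 1) + b (k + 1))) +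
        ((2 : ℝ) • P (z (k + 1) - z' k) - (z (k + 1) - z' k)) := by
      simp only [T, ← hz', hb']
      rw [show q (k + 1) = S (x (k + 2)) - b (k + 1) from rfl, hb']
      simp only [map_sub, map_add, map_smul]
      module
    have h1 : ‖P (z (k + 1) - z' k)‖ ≤ ‖z (k + 1) - z' k‖ :=
      Submodule.norm_starProjection_apply_le _ _
    rw [e]
    have h2 : ‖(2 : ℝ) • P (z (k + 1) - z' k)‖ = 2 * ‖P (z (k + 1) - z' k)‖ := by
      rw [norm_smul, Real.norm_ofNat]
    have h3 := norm_add_le (S (x (k + 2)) - P (z (k + 1) + b (k + 1)))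
      ((2 : ℝ) • P (z (k + 1) - z' k) - (z (k + 1) - z' k))
    have h4 := norm_sub_le ((2 : ℝ) • P (z (k + 1) - z' k)) (z (k + 1) - z' k)
    linarith [hxerr (k + 1), hz'2 k]
  obtain ⟨r, hr, hqr⟩ := exists_tendsto_fixedPoint hT hfix
    ((((summable_nat_add_iff 1).2 hεx).mul_left ‖Sc‖).add (hεz.mul_left 3)) hq
  have hPr : P ((2 : ℝ) • prox r - r) = prox r := by
    have : P ((2 : ℝ) • prox r - r) - prox r + r = r := hr
    exact sub_eq_zero.1 (by simpa using this)
  obtain ⟨xhat, hxhat⟩ : prox r ∈ LinearMap.range S := by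
    rw [← hPr]
    exact Submodule.starProjection_apply_mem _ _
  have hproxc : Continuous prox :=
    (LipschitzWith.of_dist_le_mul (K := 1) fun a b => by
      simpa [dist_eq_norm] using (hprox a).norm_sub_le (hprox b)).continuous
  have hz0 : Tendsto (fun k => z (k + 1) - z' k) atTop (𝓝 0) :=
    squeeze_zero_norm hz'2 hεz.tendsto_atTop_zero
  have hz1 : Tendsto (fun k => z (k + 1)) atTop (𝓝 (prox r)) := by
    have := hz0.add ((hproxc.tendsto r).comp hqr)
    rw [zero_add] at this
    refine this.congr fun k => ?_
    simp [hz']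
  have hs0 : Tendsto (fun k => S (x (k + 1)) - P (z k + b k)) atTop (𝓝 0) :=
    squeeze_zero_norm hxerr (by simpa using hεx.tendsto_atTop_zero.const_mul ‖Sc‖)
  have hs1 : Tendsto (fun k => S (x (k + 2))) atTop (𝓝 (prox r)) := by
    have h1 : Tendsto (fun k => P (z (k + 1) + b (k + 1))) atTop
        (𝓝 (P (prox r + (prox r - r)))) := by
      refine (P.continuous.tendsto _).comp (hz1.add ?_)
      exact (hz1.sub hqr).congr fun k => (hb' k).symm
    rw [← add_sub_assoc, ← two_smul ℝ, hPr] at h1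
    have := (hs0.comp (tendsto_add_atTop_nat 1)).add h1
    rw [zero_add] at this
    refine this.congr fun k => ?_
    simp
  refine ⟨xhat, fun w => ?_, ?_, ?_⟩
  -- At a fixed point, `r - prox r` is both a subgradient at `prox r` and orthogonal to the range,
  -- so the linear term in the prox inequality drops out.
  · have h1 := hprox r (S w)
    rw [← hxhat] at h1
    have h2 : ⟪(2 : ℝ) • prox r - r - P ((2 : ℝ) • prox r - r), S (w - xhat)⟫ = 0 :=
      Submodule.starProjection_inner_eq_zero _ _ ⟨_, rfl⟩
    rw [hPr, show (2 : ℝ) • prox r - r - prox r = -(r - prox r) by module, inner_neg_left,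
      neg_eq_zero, map_sub, ← hxhat] at h2
    linarith
  · have hemb : IsInducing Sc :=
      (LinearMap.isClosedEmbedding_of_injective (f := S)
        (LinearMap.ker_eq_bot.2 hS)).isInducing
    rw [← tendsto_add_atTop_iff_nat 2, hemb.tendsto_nhds_iff]
    change Tendsto (fun k => S (x (k + 2))) atTop (𝓝 (S xhat))
    rwa [hxhat]
  · rw [hxhat]
    exact (tendsto_add_atTop_iff_nat 1).1 hz1

end Abstract

/-! ### Elimination of `d` and equivalence of the algorithms -/

/-- Matrix-vector product as a linear map. -/
noncomputable def mvLin {m n : ℕ} (M : Matrix (Fin m) (Fin n) ℝ) : Vec n →ₗ[ℝ] Vec m where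
  toFun := mv M
  map_add' a b := by simp [mv, Matrix.mulVec_add]
  map_smul' c a := by simp [mv, Matrix.mulVec_smul]

section

variable {n p m : ℕ} {A : Matrix (Fin p) (Fin n) ℝ} {Θ : Matrix (Fin m) (Fin n) ℝ} {y : Vec p}
  {Φ : Vec m → ℝ} {ρ η : ℝ}

lemma isArgmin_iff {f : Vec n → ℝ} {x : Vec n} : IsArgmin f x ↔ ∀ w, f x ≤ f w := by
  simp [IsArgmin, isMinOn_univ_iff]

lemma FullColumnRank.eq_zero (h : FullColumnRank A Θ) {x : Vec n} (hA : mv A x = 0)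
    (hΘ : mv Θ x = 0) : x = 0 := by
  have hli : LinearIndependent ℝ (Matrix.fromRows A Θ).col := by
    rw [linearIndependent_iff_card_eq_finrank_span, Set.finrank, ← Matrix.rank_eq_finrank_span_cols]
    simpa using h.symm
  have hinj := Matrix.mulVec_injective_iff.2 hli
  have h0 : (Matrix.fromRows A Θ).mulVec x.ofLp = (Matrix.fromRows A Θ).mulVec 0 := by
    rw [Matrix.fromRows_mulVec, Matrix.mulVec_zero]
    have h1 : A.mulVec x.ofLp = 0 := congrArg WithLp.ofLp hA
    have h2 : Θ.mulVec x.ofLp = 0 := congrArg WithLp.ofLp hΘ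
    ext (i | i) <;> simp [h1, h2]
  exact WithLp.ofLp_injective 2 (hinj h0)

/-- The `u`-subproblem has a unique minimizer, in closed form. -/
lemma isArgmin_admmCostU_iff (hρ : 0 < ρ) {x : Vec n} {d u : Vec p} :
    IsArgmin (admmCostU A y ρ x d) u ↔ (1 + ρ) • u = y + ρ • (mv A x - d) := by
  -- Completing the square about a stationary point `c`; the cost has curvature `1 + ρ`.
  have key : ∀ c w : Vec p, (1 + ρ) • c = y + ρ • (mv A x - d) →
      admmCostU A y ρ x d w = admmCostU A y ρ x d c + (1 + ρ) / 2 * ‖w - c‖ ^ 2 := by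
    intro c w hc
    have h1 : ⟪(1 + ρ) • c - (y + ρ • (mv A x - d)), w - c⟫ = 0 := by
      rw [hc, sub_self, inner_zero_left]
    have e1 : ‖y - w‖ ^ 2 = ‖y - c‖ ^ 2 - 2 * ⟪y - c, w - c⟫ + ‖w - c‖ ^ 2 := by
      rw [← norm_sub_sq_real, sub_sub_sub_cancel_right]
    have e2 : ‖mv A x - w - d‖ ^ 2 =
        ‖mv A x - c - d‖ ^ 2 - 2 * ⟪mv A x - c - d, w - c⟫ + ‖w - c‖ ^ 2 := by
      rw [← norm_sub_sq_real]
      congr 2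
      abel
    have e3 : (1 + ρ) • c - (y + ρ • (mv A x - d)) = -(y - c) - ρ • (mv A x - c - d) := by
      module
    rw [e3, inner_sub_left, inner_neg_left, inner_smul_left, RCLike.conj_to_real] at h1
    unfold admmCostU
    rw [e1, e2]
    linear_combination h1
  have hρ1 : (1 + ρ) ≠ 0 := by positivity
  rw [isArgmin_iff]
  constructor
  · intro h
    set c := (1 + ρ)⁻¹ • (y + ρ • (mv A x - d)) with hc
    have hc' : (1 + ρ) • c = y + ρ • (mv A x - d) := by rw [hc, smul_inv_smul₀ hρ1]
    have h1 := h c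
    rw [key c u hc'] at h1
    have h2 : ‖u - c‖ ^ 2 ≤ 0 := by
      by_contra! hlt
      have : 0 < (1 + ρ) / 2 * ‖u - c‖ ^ 2 := by positivity
      linarith
    have h3 : u = c := by
      rw [← sub_eq_zero, ← norm_eq_zero]
      exact pow_eq_zero_iff two_ne_zero |>.1 (le_antisymm h2 (sq_nonneg _))
    rw [h3, hc']
  · intro h w
    rw [key u w h]
    have : 0 ≤ (1 + ρ) / 2 * ‖w - u‖ ^ 2 := by positivity
    linarith

/-- The stationarity condition of the `u`-step, rearranged. Nothing is asked of the incoming `d`, so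
one step enforces the identity and the initialization matters only at index `0`. -/
lemma u_add_smul_d_eq (hρ : 0 < ρ) {x : Vec n} {d u : Vec p}
    (h : IsArgmin (admmCostU A y ρ x d) u) : u + ρ • (d - mv A x + u) = y := by
  rw [show u + ρ • (d - mv A x + u) = (1 + ρ) • u - ρ • (mv A x - d) by module,
    (isArgmin_admmCostU_iff hρ).1 h, add_sub_cancel_right]

lemma IsADMM.u_add_smul_d {x : ℕ → Vec n} {u : ℕ → Vec p} {v : ℕ → Vec m}
    {d : ℕ → Vec p} {e : ℕ → Vec m} (hρ : 0 < ρ) (h : IsADMM A Θ y Φ ρ η x u v d e)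
    (h0 : d 0 = ρ⁻¹ • (y - u 0)) (k : ℕ) : u k + ρ • d k = y := by
  cases k with
  | zero => rw [h0, smul_inv_smul₀ hρ.ne', add_sub_cancel]
  | succ k => rw [h.d_update k, u_add_smul_d_eq hρ (h.u_update k)]

/-- The target `u + d` of the penalty equals `ρ⁻¹ y + (1 - ρ⁻¹) u`. -/
lemma admmCostX_eq_simplifiedCostX {u d : Vec p} {v e : Vec m} (hd : d = ρ⁻¹ • (y - u)) :
    admmCostX A Θ ρ η u v d e = simplifiedCostX A Θ y ρ η u v e := by
  funext x
  have : mv A x - u - d = mv A x - ρ⁻¹ • y - (1 - ρ⁻¹) • u := by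
    rw [hd]
    module
  rw [admmCostX, simplifiedCostX, this]

/-- Substituting `d` cancels `y` in the stationarity condition, leaving `(1 + ρ) u' = ρ A x + u`. -/
lemma isArgmin_admmCostU_iff_relaxation (hρ : 0 < ρ) {x : Vec n} {d u u' : Vec p}
    (hd : d = ρ⁻¹ • (y - u)) : IsArgmin (admmCostU A y ρ x d) u' ↔
      u' = (ρ / (ρ + 1)) • mv A x + (1 / (ρ + 1)) • u := by
  have hρ1 : (1 + ρ) ≠ 0 := by positivity
  rw [isArgmin_admmCostU_iff hρ, hd, ← (smul_right_injective (Vec p) hρ1).eq_iff (a := u')]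
  simp only [smul_add, smul_sub, smul_smul, mul_inv_cancel₀ hρ.ne', one_smul, add_comm ρ 1,
    mul_div_cancel₀ _ hρ1]
  rw [show y + (ρ • mv A x - (y - u)) = ρ • mv A x + u by abel]

lemma isADMM_iff_isSimplifiedADMM {x : ℕ → Vec n} {u : ℕ → Vec p} {v : ℕ → Vec m}
    {d : ℕ → Vec p} {e : ℕ → Vec m} (hρ : 0 < ρ) :
    (IsADMM A Θ y Φ ρ η x u v d e ∧ d 0 = ρ⁻¹ • (y - u 0)) ↔
      (IsSimplifiedADMM A Θ y Φ ρ η x u v e ∧ ∀ k, d k = ρ⁻¹ • (y - u k)) := by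
  constructor
  · rintro ⟨h, h0⟩
    have hd : ∀ k, d k = ρ⁻¹ • (y - u k) := fun k => by
      rw [← h.u_add_smul_d hρ h0 k, add_sub_cancel_left, inv_smul_smul₀ hρ.ne']
    refine ⟨⟨fun k => ?_, fun k => ?_, h.v_update, h.e_update⟩, hd⟩
    · rw [← admmCostX_eq_simplifiedCostX (hd k)]
      exact h.x_update k
    · exact (isArgmin_admmCostU_iff_relaxation hρ (hd k)).1 (h.u_update k)
  · rintro ⟨h, hd⟩
    have hu : ∀ k, IsArgmin (admmCostU A y ρ (x (k + 1)) (d k)) (u (k + 1)) := fun k =>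
      (isArgmin_admmCostU_iff_relaxation hρ (hd k)).2 (h.u_update k)
    refine ⟨⟨fun k => ?_, hu, h.v_update, fun k => ?_, h.e_update⟩, hd 0⟩
    · rw [admmCostX_eq_simplifiedCostX (hd k)]
      exact h.x_update k
    · rw [hd (k + 1), inv_smul_eq_iff₀ hρ.ne', sub_eq_iff_eq_add', u_add_smul_d_eq hρ (hu k)]

/-- The coefficient `1 - ρ⁻¹` of `u` vanishes at `ρ = 1`, so the `x`-step no longer depends on `u`.
-/
lemma simplifiedCostX_one (u : Vec p) (v e : Vec m) :
    simplifiedCostX A Θ y 1 η u v e = sbCostX A Θ y η v e := by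
  funext x
  simp [simplifiedCostX, sbCostX, norm_sub_rev]

/-- The `u`-iterates of the simplified ADMM with `ρ = 1` determined by its `x`-iterates. -/
noncomputable def averagedImages (A : Matrix (Fin p) (Fin n) ℝ) (x : ℕ → Vec n) (u₀ : Vec p) :
    ℕ → Vec p
  | 0 => u₀
  -- The coefficients stay unevaluated so that the simplified `u`-update at `ρ = 1` holds by `rfl`.
  | k + 1 => ((1 : ℝ) / (1 + 1)) • mv A (x (k + 1)) + ((1 : ℝ) / (1 + 1)) • averagedImages A x u₀ k

lemma isSB_iff_exists_isADMM (u₀ : Vec p) {x : ℕ → Vec n} {v e : ℕ → Vec m} :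
    IsSB A Θ y Φ η x v e ↔
      ∃ u d : ℕ → Vec p, u 0 = u₀ ∧ d 0 = y - u 0 ∧ IsADMM A Θ y Φ 1 η x u v d e := by
  constructor
  · intro h
    have hs : IsSimplifiedADMM A Θ y Φ 1 η x (averagedImages A x u₀) v e :=
      ⟨fun k => simplifiedCostX_one (A := A) (Θ := Θ) (y := y) _ _ _ ▸ h.x_update k,
        fun _ => rfl, h.v_update, h.e_update⟩
    have := (isADMM_iff_isSimplifiedADMM one_pos).2
      ⟨hs, fun k => (rfl : (1 : ℝ)⁻¹ • (y - averagedImages A x u₀ k) = _)⟩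
    exact ⟨_, _, rfl, by simp, this.1⟩
  · rintro ⟨u, d, -, hd, h⟩
    obtain ⟨hs, -⟩ := (isADMM_iff_isSimplifiedADMM one_pos).1 ⟨h, by simpa using hd⟩
    exact ⟨fun k => simplifiedCostX_one (A := A) (Θ := Θ) (y := y) _ _ _ ▸ hs.x_update k,
      hs.v_update, hs.e_update⟩

/-- The auxiliary `u` is built from the actual inexact `x`, so its own error is `0` and `d = y - u`
persists; the start `u 0 = 0` is an arbitrary choice. -/
lemma IsInexactSB.exists_isInexactADMM {εx εv : ℕ → ℝ} {x : ℕ → Vec n} {v e : ℕ → Vec m}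
    (h : IsInexactSB A Θ y Φ η εx εv x v e) :
    ∃ u d : ℕ → Vec p, IsInexactADMM A Θ y Φ 1 η εx 0 εv x u v d e := by
  let u := averagedImages A x 0
  have hd : ∀ k, y - u k = (1 : ℝ)⁻¹ • (y - u k) := fun k => by simp
  have hu : ∀ k, IsArgmin (admmCostU A y 1 (x (k + 1)) (y - u k)) (u (k + 1)) := fun k =>
    (isArgmin_admmCostU_iff_relaxation one_pos (hd k)).2 rfl
  refine ⟨u, fun k => y - u k, fun k => ?_, fun k => ⟨_, hu k, by simp⟩, h.v_update, fun k => ?_,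
    h.e_update⟩
  · rw [admmCostX_eq_simplifiedCostX (hd k), simplifiedCostX_one]
    exact h.x_update k
  · have := u_add_smul_d_eq one_pos (hu k)
    rw [one_smul] at this
    exact sub_eq_iff_eq_add'.2 this.symm

/-! ### Reduction of the two-split ADMM to the abstract scheme by scaling -/

/-- Euclidean product space carrying the scaled splitting variables. -/
abbrev Prod2 (p m : ℕ) : Type := WithLp 2 (Vec p × Vec m)

/-- The pair `(√ρ u, √η v)`, on which the Euclidean norm is the penalty norm of the ADMM. -/
noncomputable def scaledPair (ρ η : ℝ) : (Vec p × Vec m) →ₗ[ℝ] Prod2 p m :=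
  (WithLp.linearEquiv 2 ℝ (Vec p × Vec m)).symm.toLinearMap ∘ₗ
    (LinearMap.prodMap (√ρ • LinearMap.id) (√η • LinearMap.id))

lemma norm_scaledPair_sq (hρ : 0 < ρ) (hη : 0 < η) (w : Vec p × Vec m) :
    ‖scaledPair ρ η w‖ ^ 2 = ρ * ‖w.1‖ ^ 2 + η * ‖w.2‖ ^ 2 := by
  rw [WithLp.prod_norm_sq_eq_of_L2]
  simp [scaledPair, norm_smul, mul_pow, Real.sq_sqrt hρ.le, Real.sq_sqrt hη.le]

lemma norm_scaledPair_le (hρ : 0 < ρ) (hη : 0 < η) (w : Vec p × Vec m) :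
    ‖scaledPair ρ η w‖ ≤ √ρ * ‖w.1‖ + √η * ‖w.2‖ := by
  refine le_of_sq_le_sq ?_ (by positivity)
  rw [norm_scaledPair_sq hρ hη, add_sq, mul_pow, mul_pow, Real.sq_sqrt hρ.le, Real.sq_sqrt hη.le]
  have : 0 ≤ 2 * (√ρ * ‖w.1‖) * (√η * ‖w.2‖) := by positivity
  linarith

lemma norm_fst_le_scaledPair (hρ : 0 < ρ) (hη : 0 < η) (w : Vec p × Vec m) :
    ‖w.1‖ ≤ (√ρ)⁻¹ * ‖scaledPair ρ η w‖ := by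
  rw [le_inv_mul_iff₀ (Real.sqrt_pos.2 hρ)]
  refine le_of_sq_le_sq ?_ (norm_nonneg _)
  rw [norm_scaledPair_sq hρ hη, mul_pow, Real.sq_sqrt hρ.le]
  exact le_add_of_nonneg_right (by positivity)

lemma norm_snd_le_scaledPair (hρ : 0 < ρ) (hη : 0 < η) (w : Vec p × Vec m) :
    ‖w.2‖ ≤ (√η)⁻¹ * ‖scaledPair ρ η w‖ := by
  rw [le_inv_mul_iff₀ (Real.sqrt_pos.2 hη)]
  refine le_of_sq_le_sq ?_ (norm_nonneg _)
  rw [norm_scaledPair_sq hρ hη, mul_pow, Real.sq_sqrt hη.le]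
  exact le_add_of_nonneg_left (by positivity)

/-- The inverse of `scaledPair`. -/
noncomputable def unscaledPair (ρ η : ℝ) : Prod2 p m →ₗ[ℝ] (Vec p × Vec m) :=
  (LinearMap.prodMap ((√ρ)⁻¹ • LinearMap.id) ((√η)⁻¹ • LinearMap.id)) ∘ₗ
    (WithLp.linearEquiv 2 ℝ (Vec p × Vec m)).toLinearMap

lemma unscaledPair_scaledPair (hρ : 0 < ρ) (hη : 0 < η) (w : Vec p × Vec m) :
    unscaledPair ρ η (scaledPair ρ η w) = w := by
  have h1 := (Real.sqrt_pos.2 hρ).ne'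
  have h2 := (Real.sqrt_pos.2 hη).ne'
  ext <;> simp [scaledPair, unscaledPair, h1, h2]

lemma scaledPair_unscaledPair (hρ : 0 < ρ) (hη : 0 < η) (w : Prod2 p m) :
    scaledPair ρ η (unscaledPair ρ η w) = w := by
  have h1 := (Real.sqrt_pos.2 hρ).ne'
  have h2 := (Real.sqrt_pos.2 hη).ne'
  refine WithLp.ofLp_injective 2 (Prod.ext ?_ ?_) <;> simp [scaledPair, unscaledPair, h1, h2]

/-- The separable objective `½‖y - u‖² + Φ v` of the two-split formulation. -/
noncomputable def splitCost (y : Vec p) (Φ : Vec m → ℝ) (w : Vec p × Vec m) : ℝ :=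
  1 / 2 * ‖y - w.1‖ ^ 2 + Φ w.2

lemma convexOn_splitCost (hΦ : ConvexOn ℝ Set.univ Φ) : ConvexOn ℝ Set.univ (splitCost y Φ) := by
  have h1 : ConvexOn ℝ Set.univ fun u : Vec p => ‖y - u‖ := by
    simpa [dist_eq_norm, norm_sub_rev] using convexOn_univ_dist y
  have h2 : ConvexOn ℝ Set.univ fun u : Vec p => 1 / 2 * ‖y - u‖ ^ 2 := by
    simpa [smul_eq_mul] using (h1.pow (fun _ _ => norm_nonneg _) 2).smul
      (show (0 : ℝ) ≤ 1 / 2 by norm_num)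
  exact (h2.comp_linearMap (LinearMap.fst ℝ (Vec p) (Vec m))).add
    (hΦ.comp_linearMap (LinearMap.snd ℝ (Vec p) (Vec m)))

/-- Convergence of the inexact two-split ADMM. -/
theorem IsInexactADMM.tendsto (hΦ : ConvexOn ℝ Set.univ Φ) (hρ : 0 < ρ) (hη : 0 < η)
    (hrank : FullColumnRank A Θ) (hmin : ∃ x₀, IsArgmin (cost A Θ y Φ) x₀)
    {εx εu εv : ℕ → ℝ} (hεx : Summable εx) (hεu : Summable εu) (hεv : Summable εv)
    {x : ℕ → Vec n} {u : ℕ → Vec p} {v : ℕ → Vec m} {d : ℕ → Vec p} {e : ℕ → Vec m}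
    (h : IsInexactADMM A Θ y Φ ρ η εx εu εv x u v d e) :
    ∃ xhat, IsArgmin (cost A Θ y Φ) xhat ∧ Tendsto x atTop (𝓝 xhat) ∧
      Tendsto u atTop (𝓝 (mv A xhat)) ∧ Tendsto v atTop (𝓝 (mv Θ xhat)) := by
  let S : Vec n →ₗ[ℝ] Prod2 p m := scaledPair ρ η ∘ₗ (mvLin A).prod (mvLin Θ)
  have hSdef : ∀ w, S w = scaledPair ρ η (mv A w, mv Θ w) := fun _ => rfl
  have hS : Function.Injective S := by
    rw [injective_iff_map_eq_zero]
    intro w hw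
    have := congrArg (unscaledPair ρ η) hw
    rw [hSdef, unscaledPair_scaledPair hρ hη, map_zero, Prod.mk_eq_zero] at this
    exact hrank.eq_zero this.1 this.2
  let g : Prod2 p m → ℝ := fun w => splitCost y Φ (unscaledPair ρ η w)
  have hg : ConvexOn ℝ Set.univ g := (convexOn_splitCost hΦ).comp_linearMap (unscaledPair ρ η)
  have hgs : ∀ w, g (scaledPair ρ η w) = splitCost y Φ w := fun w => by
    simp only [g, unscaledPair_scaledPair hρ hη]
  have hgS : ∀ w, g (S w) = cost A Θ y Φ w := fun w => hgs _
  let z : ℕ → Prod2 p m := fun k => scaledPair ρ η (u k, v k)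
  let b : ℕ → Prod2 p m := fun k => scaledPair ρ η (d k, e k)
  have hx : ∀ k, ∃ x', (∀ w, ‖S x' - (z k + b k)‖ ≤ ‖S w - (z k + b k)‖) ∧
      ‖x (k + 1) - x'‖ ≤ εx k := fun k => by
    obtain ⟨x', h1, h2⟩ := h.x_update k
    rw [isArgmin_iff] at h1
    have hc : ∀ w, ‖S w - (z k + b k)‖ ^ 2 = 2 * admmCostX A Θ ρ η (u k) (v k) (d k) (e k) w :=
      fun w => by
        simp only [hSdef, z, b, ← map_add, ← map_sub]
        rw [norm_scaledPair_sq hρ hη]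
        simp only [Prod.mk_add_mk, Prod.mk_sub_mk, admmCostX, sub_sub]
        ring
    refine ⟨x', fun w => le_of_sq_le_sq ?_ (norm_nonneg _), h2⟩
    rw [hc, hc]
    linarith [h1 w]
  have hz : ∀ k, ∃ z', (∀ w, g z' + 1 / 2 * ‖z' - (S (x (k + 1)) - b k)‖ ^ 2 ≤
      g w + 1 / 2 * ‖w - (S (x (k + 1)) - b k)‖ ^ 2) ∧
      ‖z (k + 1) - z'‖ ≤ √ρ * εu k + √η * εv k := fun k => by
    obtain ⟨u', hu1, hu2⟩ := h.u_update k
    obtain ⟨v', hv1, hv2⟩ := h.v_update k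
    rw [isArgmin_iff] at hu1 hv1
    -- The scaled proximal objective separates, so the independent `u`- and `v`-minimizations
    -- together form one proximal step.
    have hc : ∀ w : Vec p × Vec m, g (scaledPair ρ η w) +
        1 / 2 * ‖scaledPair ρ η w - (S (x (k + 1)) - b k)‖ ^ 2 =
        admmCostU A y ρ (x (k + 1)) (d k) w.1 + costV Θ Φ η (x (k + 1)) (e k) w.2 := fun w => by
      rw [hgs]
      simp only [hSdef, b, ← map_sub]
      rw [norm_scaledPair_sq hρ hη]
      simp only [Prod.mk_sub_mk, Prod.fst_sub, Prod.snd_sub, splitCost, admmCostU, costV]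
      rw [norm_sub_rev w.1, norm_sub_rev w.2, sub_right_comm, sub_right_comm _ _ w.2]
      ring
    refine ⟨scaledPair ρ η (u', v'), fun w => ?_, ?_⟩
    · rw [← scaledPair_unscaledPair hρ hη w, hc, hc]
      exact add_le_add (hu1 _) (hv1 _)
    · simp only [z, ← map_sub]
      exact (norm_scaledPair_le hρ hη _).trans
        (add_le_add (mul_le_mul_of_nonneg_left hu2 (Real.sqrt_nonneg _))
          (mul_le_mul_of_nonneg_left hv2 (Real.sqrt_nonneg _)))
  have hb : ∀ k, b (k + 1) = b k - S (x (k + 1)) + z (k + 1) := fun k => by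
    simp only [b, z, hSdef, ← map_sub, ← map_add, Prod.mk_sub_mk, Prod.mk_add_mk, h.d_update,
      h.e_update]
  obtain ⟨xhat, h1, h2, h3⟩ := inexact_admm_tendsto S hS hg
    (by simpa only [hgS, ← isArgmin_iff] using hmin) hεx ((hεu.mul_left _).add (hεv.mul_left _)) hx hz hb
  have h4 : Tendsto (fun k => ‖scaledPair ρ η (u k - mv A xhat, v k - mv Θ xhat)‖) atTop
      (𝓝 0) := by
    refine (tendsto_iff_norm_sub_tendsto_zero.1 h3).congr fun k => ?_
    simp only [z, hSdef, ← map_sub, Prod.mk_sub_mk]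
  exact ⟨xhat, isArgmin_iff.2 (by simpa only [hgS] using h1), h2,
    tendsto_iff_norm_sub_tendsto_zero.2 (squeeze_zero (fun _ => norm_nonneg _)
      (fun k => norm_fst_le_scaledPair hρ hη (u k - mv A xhat, v k - mv Θ xhat))
      (by simpa using h4.const_mul (√ρ)⁻¹)),
    tendsto_iff_norm_sub_tendsto_zero.2 (squeeze_zero (fun _ => norm_nonneg _)
      (fun k => norm_snd_le_scaledPair hρ hη (u k - mv A xhat, v k - mv Θ xhat))
      (by simpa using h4.const_mul (√η)⁻¹))⟩

end

end SplitBregman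

theorem mainTheorem1 {n p m : ℕ}
    (A : Matrix (Fin p) (Fin n) ℝ) (Θ : Matrix (Fin m) (Fin n) ℝ)
    (y : SplitBregman.Vec p) (Φ : SplitBregman.Vec m → ℝ) (hΦ : ConvexOn ℝ Set.univ Φ)
    (η : ℝ) (hη : 0 < η) :
    -- the identity `u + ρ d = y`
    (∀ (ρ : ℝ), 0 < ρ → ∀ (x : ℕ → SplitBregman.Vec n) (u : ℕ → SplitBregman.Vec p)
        (v : ℕ → SplitBregman.Vec m) (d : ℕ → SplitBregman.Vec p) (e : ℕ → SplitBregman.Vec m),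
        SplitBregman.IsADMM A Θ y Φ ρ η x u v d e → d 0 = ρ⁻¹ • (y - u 0) →
          ∀ k, u k + ρ • d k = y) ∧
    -- equivalence of the two-split ADMM with its simplified form
    (∀ (ρ : ℝ), 0 < ρ → ∀ (x : ℕ → SplitBregman.Vec n) (u : ℕ → SplitBregman.Vec p)
        (v : ℕ → SplitBregman.Vec m) (d : ℕ → SplitBregman.Vec p) (e : ℕ → SplitBregman.Vec m),
        (SplitBregman.IsADMM A Θ y Φ ρ η x u v d e ∧ d 0 = ρ⁻¹ • (y - u 0)) ↔
          (SplitBregman.IsSimplifiedADMM A Θ y Φ ρ η x u v e ∧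
            ∀ k, d k = ρ⁻¹ • (y - u k))) ∧
    -- for `ρ = 1` the two-split ADMM is the split Bregman method
    (∀ (u₀ : SplitBregman.Vec p) (x : ℕ → SplitBregman.Vec n) (v e : ℕ → SplitBregman.Vec m),
        SplitBregman.IsSB A Θ y Φ η x v e ↔
          ∃ u d : ℕ → SplitBregman.Vec p, u 0 = u₀ ∧ d 0 = y - u 0 ∧
            SplitBregman.IsADMM A Θ y Φ 1 η x u v d e) ∧
    -- convergence of the inexact two-split ADMM
    (SplitBregman.FullColumnRank A Θ →
      (∃ x₀, SplitBregman.IsArgmin (SplitBregman.cost A Θ y Φ) x₀) →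
      ∀ (ρ : ℝ), 0 < ρ → ∀ (εx εu εv : ℕ → ℝ), Summable εx → Summable εu → Summable εv →
      ∀ (x : ℕ → SplitBregman.Vec n) (u : ℕ → SplitBregman.Vec p)
        (v : ℕ → SplitBregman.Vec m) (d : ℕ → SplitBregman.Vec p) (e : ℕ → SplitBregman.Vec m),
        SplitBregman.IsInexactADMM A Θ y Φ ρ η εx εu εv x u v d e →
          ∃ xhat, SplitBregman.IsArgmin (SplitBregman.cost A Θ y Φ) xhat ∧
            Filter.Tendsto x Filter.atTop (nhds xhat) ∧
            Filter.Tendsto u Filter.atTop (nhds (SplitBregman.mv A xhat)) ∧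
            Filter.Tendsto v Filter.atTop (nhds (SplitBregman.mv Θ xhat))) ∧
    -- convergence of the inexact split Bregman method
    (SplitBregman.FullColumnRank A Θ →
      (∃ x₀, SplitBregman.IsArgmin (SplitBregman.cost A Θ y Φ) x₀) →
      ∀ (εx εv : ℕ → ℝ), Summable εx → Summable εv →
      ∀ (x : ℕ → SplitBregman.Vec n) (v e : ℕ → SplitBregman.Vec m),
        SplitBregman.IsInexactSB A Θ y Φ η εx εv x v e →
          ∃ xhat, SplitBregman.IsArgmin (SplitBregman.cost A Θ y Φ) xhat ∧
            Filter.Tendsto x Filter.atTop (nhds xhat) ∧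
            Filter.Tendsto v Filter.atTop (nhds (SplitBregman.mv Θ xhat))) := by
  refine ⟨fun ρ hρ x u v d e h h0 k => h.u_add_smul_d hρ h0 k,
    fun ρ hρ x u v d e => SplitBregman.isADMM_iff_isSimplifiedADMM hρ,
    fun u₀ x v e => SplitBregman.isSB_iff_exists_isADMM u₀,
    fun hrank hmin ρ hρ εx εu εv hεx hεu hεv x u v d e h =>
      h.tendsto hΦ hρ hη hrank hmin hεx hεu hεv,
    fun hrank hmin εx εv hεx hεv x v e h => ?_⟩
  obtain ⟨u, d, h'⟩ := h.exists_isInexactADMM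
  obtain ⟨xhat, h1, h2, -, h3⟩ := h'.tendsto hΦ one_pos hη hrank hmin hεx summable_zero hεv
  exact ⟨xhat, h1, h2, h3⟩
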